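/- Let $N \ge 2$ be an integer and let $\mathbb{R}^N_+ = \mathbb{R}^{N-1} \times (0,\infty)$, with boundary $\partial\mathbb{R}^N_+ = \mathbb{R}^{N-1}\times\{0\}$ identified with $\mathbb{R}^{N-1}$ and equipped with the $(N-1)$-dimensional Lebesgue measure. For $s \in (0,1)$ and $p \in [1,\infty)$, the homogeneous fractional Sobolev space $\dot W^{s,p}(\mathbb{R}^N_+)$ is the set of measurable functions $u : \mathbb{R}^N_+ \to \mathbb{R}$ such that $$\iint_{\mathbb{R}^N_+ \times \mathbb{R}^N_+} \frac{|u(y)-u(z)|^p}{|y-z|^{N+sp}} \,\mathrm{d}y\,\mathrm{d}z < \infty .$$ A measurable function $v : \partial\mathbb{R}^N_+ \to \mathbb{R}$ is called a trace of $u$ on $\partial \mathbb{R}^N_+$ if, for almost every $x \in \partial\mathbb{R}^N_+$, $$\lim_{r \to 0^+} \frac{1}{|B_r(x) \cap \mathbb{R}^N_+|}\int_{B_r(x) \cap \mathbb{R}^N_+} |u(y) - v(x)| \,\mathrm{d}y = 0 .$$ Theorem. For every integer $N \ge 2$, every $s \in (0,1)$ and every $p \in [1,\infty)$ satisfying $sp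 > 1$, there exists a constant $C \in (0,\infty)$ such that every $u \in \dot W^{s,p}(\mathbb{R}^N_+)$ has a trace $v$ on $\partial\mathbb{R}^N_+$, which is unique up to equality almost everywhere and satisfies $$\int_{\partial\mathbb{R}^N_+} \left( \int_{\mathbb{R}^N_+} \frac{|v(x)-u(y)|^p}{|x-y|^{N-1+sp}} \,\mathrm{d}y \right) \mathrm{d}x \le C \iint_{\mathbb{R}^N_+ \times \mathbb{R}^N_+} \frac{|u(y)-u(z)|^p}{|y-z|^{N+sp}} \,\mathrm{d}y\,\mathrm{d}z .$$ -/

import Mathlib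

open MeasureTheory Filter Topology
open scoped NNReal ENNReal

noncomputable section

/-- The open half-space `ℝ^N_+ = ℝ^(N-1) × (0, ∞)`, where `N = d + 1`:
the points of Euclidean `ℝ^N` whose last coordinate is positive. -/
def halfSpace (d : ℕ) : Set (EuclideanSpace ℝ (Fin (d + 1))) :=
  {x | 0 < x (Fin.last d)}

/-- The identification `ℝ^(N-1) ≃ ∂ℝ^N_+`, `x ↦ (x, 0)`, where `N = d + 1`. -/
def boundaryPoint {d : ℕ} (x : EuclideanSpace ℝ (Fin d)) : EuclideanSpace ℝ (Fin (d + 1)) :=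
  WithLp.toLp 2 (Fin.snoc (α := fun _ => ℝ) (fun i => x i) 0)

/-- The Gagliardo integral `∬ |u(y) - u(z)|^p / |y - z|^(N + sp) dy dz` over
`ℝ^N_+ × ℝ^N_+`, where `N = d + 1`, with values in `[0, ∞]`. -/
def gagliardoIntegral (d : ℕ) (s p : ℝ) (u : EuclideanSpace ℝ (Fin (d + 1)) → ℝ) : ℝ≥0∞ :=
  ∫⁻ y in halfSpace d, ∫⁻ z in halfSpace d,
    ‖u y - u z‖ₑ ^ p / ‖y - z‖ₑ ^ (((d + 1 : ℕ) : ℝ) + s * p)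

/-- The trace conjunction integral
`∫_{∂ℝ^N_+} (∫_{ℝ^N_+} |v(x) - u(y)|^p / |x - y|^(N - 1 + sp) dy) dx`, where `N = d + 1`,
with values in `[0, ∞]`. -/
def conjunctionIntegral (d : ℕ) (s p : ℝ) (u : EuclideanSpace ℝ (Fin (d + 1)) → ℝ)
    (v : EuclideanSpace ℝ (Fin d) → ℝ) : ℝ≥0∞ :=
  ∫⁻ x, ∫⁻ y in halfSpace d,
    ‖v x - u y‖ₑ ^ p / ‖boundaryPoint x - y‖ₑ ^ (((d + 1 : ℕ) : ℝ) - 1 + s * p)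

/-- Membership in the homogeneous fractional Sobolev space of order `s` and exponent `p` on
`ℝ^N_+`: `u` is measurable on the half-space and its Gagliardo integral is finite. Only the
values of `u` on the half-space matter. -/
structure MemHomogeneousSobolev (d : ℕ) (s p : ℝ)
    (u : EuclideanSpace ℝ (Fin (d + 1)) → ℝ) : Prop where
  aemeasurable : AEMeasurable u (volume.restrict (halfSpace d))
  gagliardoIntegral_lt_top : gagliardoIntegral d s p u < ∞

/-- `v` is the trace of `u` on `∂ℝ^N_+`: `v` is measurable and, for almost every boundary
point `x`, the mean of `|u - v(x)|` over the half-ball of centre `x` and radius `r` tends to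
`0` as `r → 0`. -/
structure IsTrace {d : ℕ} (u : EuclideanSpace ℝ (Fin (d + 1)) → ℝ)
    (v : EuclideanSpace ℝ (Fin d) → ℝ) : Prop where
  aemeasurable : AEMeasurable v volume
  tendsto_mean : ∀ᵐ x : EuclideanSpace ℝ (Fin d),
    Tendsto (fun r : ℝ =>
        (∫⁻ y in Metric.ball (boundaryPoint x) r ∩ halfSpace d, ‖u y - v x‖ₑ) /
          volume (Metric.ball (boundaryPoint x) r ∩ halfSpace d))
      (𝓝[>] 0) (𝓝 0)

end

/-! Write `N = d + 1`. Around a boundary point `x`, take the half-balls `B_k` of radius `2 ^ (-k)`,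
`k ∈ ℤ`, the oscillations `O_k(x) = ∬_{B_k × B_k} |u(y) - u(z)|^p`, and their sum with weights `2 ^
(k (2N + sp - 1))`, which is `oscillationSum`. Everything passes through this sum.

Its integral over `x` is controlled by the Gagliardo integral (`lintegral_oscillationSum_le`). By
Tonelli, a pair `(y, z)` contributes at scale `k` only if `|y - z| < 2 · 2 ^ (-k)`, and then on a
set of `x` of measure at most a constant times `2 ^ (-k (N - 1))`. The weights become `2 ^ (k (N +
sp))`, and their geometric sum over the admissible `k` is of order `|y - z| ^ (-(N + sp))`. Hence
the oscillation sum is finite at almost every `x`.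

At such an `x`, consecutive means of `u` over the `B_k` differ, to the power `p`, by at most a
constant times `2 ^ (2kN) O_k(x)`. Since `sp > 1`, a discrete Hardy inequality
(`tsum_two_rpow_mul_tsum_enorm_sub_rpow_le`) sums these increments; the means converge, and `v(x)`
is their limit. Splitting `v(x) - u(y)` through the mean at each scale bounds the inner conjunction
integral at `x` by the oscillation sum (`setLIntegral_conjunction_le`). Integration in `x` gives the
estimate.

Finiteness of that inner integral in turn yields the trace property: by Jensen, the mean of `|u -
v(x)|` over the half-ball of radius `r` is `O(r ^ ((sp - 1) / p))`. Uniqueness is the triangle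
inequality. -/

/-! ### Powers of two and Jensen's inequality -/

theorem ENNReal.two_rpow_mul_two_rpow (a b : ℝ) :
    (2 : ℝ≥0∞) ^ a * 2 ^ b = 2 ^ (a + b) :=
  (ENNReal.rpow_add a b two_ne_zero ENNReal.ofNat_ne_top).symm

theorem ENNReal.two_rpow_ne_zero (a : ℝ) : (2 : ℝ≥0∞) ^ a ≠ 0 :=
  (ENNReal.rpow_pos two_pos ENNReal.ofNat_ne_top).ne'

theorem ENNReal.two_rpow_ne_top (a : ℝ) : (2 : ℝ≥0∞) ^ a ≠ ∞ :=
  ENNReal.rpow_ne_top_of_ne_zero two_ne_zero ENNReal.ofNat_ne_top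

theorem ENNReal.tsum_two_rpow_neg_lt_top {ε : ℝ} (hε : 0 < ε) :
    ∑' i : ℕ, (2 : ℝ≥0∞) ^ (-(i * ε)) < ∞ := by
  have h : ∀ i : ℕ, (2 : ℝ≥0∞) ^ (-(i * ε)) = ((2 : ℝ≥0∞) ^ (-ε)) ^ i := fun i => by
    rw [← ENNReal.rpow_natCast, ← ENNReal.rpow_mul]; ring_nf
  simp_rw [h]
  rw [ENNReal.tsum_geometric, ENNReal.inv_lt_top]
  exact tsub_pos_of_lt (ENNReal.rpow_lt_one_of_one_lt_of_neg one_lt_two (by linarith))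

/-- Jensen's inequality for the power `p ≥ 1`, without normalizing the measure. -/
theorem lintegral_rpow_le_measure_univ_mul {α : Type*} [MeasurableSpace α] {μ : Measure α}
    {p : ℝ} (hp : 1 ≤ p) {f : α → ℝ≥0∞} (hf : AEMeasurable f μ) :
    (∫⁻ a, f a ∂μ) ^ p ≤ μ Set.univ ^ (p - 1) * ∫⁻ a, f a ^ p ∂μ := by
  have hp0 : 0 < p := by linarith
  have h := eLpNorm'_le_eLpNorm'_mul_rpow_measure_univ (μ := μ) one_pos hp hf.aestronglyMeasurable
  simp only [eLpNorm', enorm_eq_self, ENNReal.rpow_one, div_one] at h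
  refine (ENNReal.rpow_le_rpow h hp0.le).trans_eq ?_
  rw [ENNReal.mul_rpow_of_nonneg _ _ hp0.le, ← ENNReal.rpow_mul, ← ENNReal.rpow_mul,
    one_div_mul_cancel hp0.ne', ENNReal.rpow_one, mul_comm]
  congr 2
  field_simp

/-- Jensen for the measure with mass `2 ^ (-(i ε))` at `i`, applied to `2 ^ (i ε) * a i`. For `ε >
0` the total mass is finite, at the price of a growing weight on `a i ^ p`. -/
theorem ENNReal.tsum_rpow_le_weighted {p : ℝ} (hp : 1 ≤ p) (ε : ℝ) (a : ℕ → ℝ≥0∞) :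
    (∑' i, a i) ^ p ≤ (∑' i : ℕ, (2 : ℝ≥0∞) ^ (-(i * ε))) ^ (p - 1) *
      ∑' i : ℕ, 2 ^ (i * ε * (p - 1)) * a i ^ p := by
  have h := lintegral_rpow_le_measure_univ_mul hp (f := fun i : ℕ => (2 : ℝ≥0∞) ^ (i * ε) * a i)
    (μ := Measure.sum fun i : ℕ => (2 : ℝ≥0∞) ^ (-(i * ε)) • Measure.dirac i)
    (Measurable.of_discrete.aemeasurable)
  simp only [lintegral_sum_measure, lintegral_smul_measure, lintegral_dirac, smul_eq_mul,
    Measure.sum_apply _ MeasurableSet.univ, Measure.smul_apply, measure_univ, mul_one,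
    ← mul_assoc, ENNReal.two_rpow_mul_two_rpow, neg_add_cancel, ENNReal.rpow_zero, one_mul,
    ENNReal.mul_rpow_of_nonneg _ _ (zero_le_one.trans hp), ← ENNReal.rpow_mul] at h
  refine h.trans_eq ?_
  congr 3 with i
  ring_nf

/-! ### Power kernels as dyadic sums -/

/-- The dyadic sum `∑ 2 ^ (k α)` over all `k ∈ ℤ` with `ρ < 2 ^ (-k)`, which is comparable to
`ρ ^ (-α)`. -/
noncomputable def dyadicKernel (α : ℝ) (ρ : ℝ≥0∞) : ℝ≥0∞ :=
  ∑' k : ℤ, {k : ℤ | ρ < (2 : ℝ≥0∞) ^ (-(k : ℝ))}.indicator (fun k => (2 : ℝ≥0∞) ^ (k * α)) k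

theorem ENNReal.rpow_neg_le_rpow_neg {x y : ℝ≥0∞} (h : x ≤ y) {α : ℝ} (hα : 0 ≤ α) :
    y ^ (-α) ≤ x ^ (-α) := by
  rw [ENNReal.rpow_neg, ENNReal.rpow_neg]
  exact ENNReal.inv_le_inv.2 (ENNReal.rpow_le_rpow h hα)

theorem ENNReal.exists_two_rpow_bounds {ρ : ℝ≥0∞} (h0 : ρ ≠ 0) (ht : ρ ≠ ∞) :
    ∃ m : ℤ, 2 ^ (-(m : ℝ) - 1) ≤ ρ ∧ ρ < 2 ^ (-(m : ℝ)) := by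
  obtain ⟨n, h1, h2⟩ := ENNReal.exists_mem_Ico_zpow h0 ht one_lt_two ENNReal.ofNat_ne_top
  refine ⟨-n - 1, ?_, ?_⟩
  · rw [← ENNReal.rpow_intCast] at h1
    rwa [show -((-n - 1 : ℤ) : ℝ) - 1 = n by push_cast; ring]
  · rw [← ENNReal.rpow_intCast] at h2
    rwa [show -((-n - 1 : ℤ) : ℝ) = (n + 1 : ℤ) by push_cast; ring]

/-- The term of the largest admissible `k` suffices: there `ρ` is within a factor two of `2 ^ (-k)`.
-/
theorem rpow_neg_le_dyadicKernel {α : ℝ} (hα : 0 < α) {ρ : ℝ≥0∞} (h0 : ρ ≠ 0) :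
    ρ ^ (-α) ≤ 2 ^ α * dyadicKernel α ρ := by
  rcases eq_or_ne ρ ∞ with rfl | ht
  · simp [ENNReal.top_rpow_of_neg (neg_lt_zero.2 hα)]
  obtain ⟨m, h1, h2⟩ := ENNReal.exists_two_rpow_bounds h0 ht
  have h3 : (2 : ℝ≥0∞) ^ (m * α) ≤ dyadicKernel α ρ := by
    refine le_trans ?_ (ENNReal.le_tsum m)
    rw [Set.indicator_of_mem (by exact h2)]
  calc ρ ^ (-α) ≤ (2 ^ (-(m : ℝ) - 1)) ^ (-α) :=
        ENNReal.rpow_neg_le_rpow_neg h1 hα.le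
    _ = 2 ^ α * 2 ^ (m * α) := by
        rw [← ENNReal.rpow_mul, ENNReal.two_rpow_mul_two_rpow]; ring_nf
    _ ≤ _ := by gcongr

/-- Going down from the largest admissible index, the terms decay geometrically, and the first is at
most `ρ ^ (-α)`. -/
theorem dyadicKernel_le {α : ℝ} (hα : 0 < α) (ρ : ℝ≥0∞) :
    dyadicKernel α ρ ≤ (∑' i : ℕ, (2 : ℝ≥0∞) ^ (-(i * α))) * ρ ^ (-α) := by
  have hW : ∑' i : ℕ, (2 : ℝ≥0∞) ^ (-(i * α)) ≠ 0 := fun h =>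
    ENNReal.two_rpow_ne_zero _ (ENNReal.tsum_eq_zero.1 h 0)
  rcases eq_or_ne ρ 0 with rfl | h0
  · simp [ENNReal.zero_rpow_of_neg (neg_lt_zero.2 hα), ENNReal.mul_top hW]
  rcases eq_or_ne ρ ∞ with rfl | ht
  · simp [dyadicKernel]
  obtain ⟨m, h1, h2⟩ := ENNReal.exists_two_rpow_bounds h0 ht
  have hinj : Function.Injective (fun i : ℕ => m - (i : ℤ)) := fun i j hij => by
    simpa using hij
  rw [dyadicKernel, ← hinj.tsum_eq, ← ENNReal.tsum_mul_right]
  · refine ENNReal.tsum_le_tsum fun i => (Set.indicator_le_self' (by simp) _).trans ?_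
    have : (2 : ℝ≥0∞) ^ (m * α) ≤ ρ ^ (-α) := by
      have := ENNReal.rpow_neg_le_rpow_neg h2.le hα.le
      rw [← ENNReal.rpow_mul] at this
      convert this using 2; ring
    refine le_trans (le_of_eq ?_) (mul_le_mul_right this _)
    rw [ENNReal.two_rpow_mul_two_rpow]; congr 1; push_cast; ring
  · intro k hk
    have hk' : ρ < 2 ^ (-(k : ℝ)) := by
      by_contra hcon
      exact hk (Set.indicator_of_notMem (s := {k : ℤ | ρ < (2 : ℝ≥0∞) ^ (-(k : ℝ))}) hcon _)
    have hlt : (2 : ℝ≥0∞) ^ (-(m : ℝ) - 1) < 2 ^ (-(k : ℝ)) := h1.trans_lt hk'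
    have : -(m : ℝ) - 1 < -(k : ℝ) := by
      by_contra! hcon
      exact absurd (ENNReal.rpow_le_rpow_of_exponent_le one_le_two hcon) (not_le.2 hlt)
    have hkm : k < m + 1 := by
      have : (k : ℝ) < m + 1 := by linarith
      exact_mod_cast this
    exact ⟨(m - k).toNat, by simp only; omega⟩

/-! ### Averages and integrability from finite oscillation -/

theorem enorm_sub_average_rpow_le {α : Type*} [MeasurableSpace α] {μ : Measure α}
    [IsFiniteMeasure μ] [NeZero μ] {p : ℝ} (hp : 1 ≤ p) {u : α → ℝ} (hu : Integrable u μ) (c : ℝ) :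
    ‖c - ⨍ a, u a ∂μ‖ₑ ^ p ≤ (μ Set.univ)⁻¹ * ∫⁻ a, ‖c - u a‖ₑ ^ p ∂μ := by
  set ν : Measure α := (μ Set.univ)⁻¹ • μ with hν
  have hprob : IsProbabilityMeasure ν := by rw [hν]; infer_instance
  have huν : Integrable u ν := hu.smul_measure (by simp [NeZero.ne μ])
  have hcu : Integrable (fun a => c - u a) ν := (integrable_const c).sub huν
  have h1 : c - ⨍ a, u a ∂μ = ∫ a, (c - u a) ∂ν := by
    rw [integral_sub (integrable_const c) huν]; simp [average, hν]
  calc ‖c - ⨍ a, u a ∂μ‖ₑ ^ p ≤ (∫⁻ a, ‖c - u a‖ₑ ∂ν) ^ p := by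
        rw [h1]
        exact ENNReal.rpow_le_rpow (enorm_integral_le_lintegral_enorm _) (by linarith)
    _ ≤ ∫⁻ a, ‖c - u a‖ₑ ^ p ∂ν := by
        simpa using lintegral_rpow_le_measure_univ_mul hp (μ := ν) hcu.aestronglyMeasurable.enorm
    _ = _ := by rw [hν, lintegral_smul_measure, smul_eq_mul]

/-- Membership in the homogeneous space does not include local integrability; this recovers it where
the oscillation is finite, so that the means of `u` are genuine. Some `u y - u` lies in `L^p`, hence
in `L^1` as the measure is finite, and `u` differs from it by a sign and a constant. -/
theorem integrable_of_lintegral_enorm_sub_rpow {α : Type*} [MeasurableSpace α] {μ : Measure α}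
    [IsFiniteMeasure μ] [NeZero μ] {p : ℝ} (hp : 1 ≤ p) {u : α → ℝ} (hu : AEStronglyMeasurable u μ)
    (h : ∫⁻ y, ∫⁻ z, ‖u y - u z‖ₑ ^ p ∂μ ∂μ ≠ ∞) : Integrable u μ := by
  obtain ⟨y, hy⟩ : ∃ y, ∫⁻ z, ‖u y - u z‖ₑ ^ p ∂μ < ∞ := by
    by_contra! hcon
    refine h ?_
    simp [fun y => top_le_iff.1 (hcon y), ENNReal.top_mul, NeZero.ne μ]
  have hm : AEStronglyMeasurable (fun z => u y - u z) μ := aestronglyMeasurable_const.sub hu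
  have hi : Integrable (fun z => u y - u z) μ := by
    refine ⟨hm, ?_⟩
    have h1 := lintegral_rpow_le_measure_univ_mul hp hm.enorm
    have h2 : (∫⁻ z, ‖u y - u z‖ₑ ∂μ) ^ p < ∞ :=
      h1.trans_lt (ENNReal.mul_lt_top (ENNReal.rpow_lt_top_of_nonneg (by linarith)
        (measure_ne_top _ _)) hy)
    exact (ENNReal.rpow_lt_top_iff_of_pos (by linarith)).1 h2
  exact ((integrable_const (u y)).sub hi).congr (by simp [Filter.EventuallyEq])

/-! ### Geometry of half-balls centred on the boundary -/

section HalfBall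

variable {d : ℕ}

@[simp] theorem boundaryPoint_last (x : EuclideanSpace ℝ (Fin d)) :
    boundaryPoint x (Fin.last d) = 0 := by
  simp [boundaryPoint]

@[simp] theorem boundaryPoint_castSucc (x : EuclideanSpace ℝ (Fin d)) (i : Fin d) :
    boundaryPoint x i.castSucc = x i := by
  simp [boundaryPoint]

theorem continuous_boundaryPoint : Continuous (boundaryPoint (d := d)) := by
  refine (PiLp.continuous_toLp 2 _).comp (continuous_pi fun i => ?_)
  refine Fin.lastCases ?_ (fun j => ?_) i
  · simpa using continuous_const
  · simpa using (EuclideanSpace.proj j : EuclideanSpace ℝ (Fin d) →L[ℝ] ℝ).continuous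

@[fun_prop] theorem measurable_boundaryPoint : Measurable (boundaryPoint (d := d)) :=
  continuous_boundaryPoint.measurable

theorem isOpen_halfSpace : IsOpen (halfSpace d) :=
  isOpen_lt continuous_const
    (EuclideanSpace.proj (Fin.last d) : EuclideanSpace ℝ (Fin (d + 1)) →L[ℝ] ℝ).continuous

theorem measurableSet_halfSpace : MeasurableSet (halfSpace d) := isOpen_halfSpace.measurableSet

theorem enorm_boundaryPoint_sub_ne_zero (x : EuclideanSpace ℝ (Fin d))
    {y : EuclideanSpace ℝ (Fin (d + 1))} (hy : y ∈ halfSpace d) : ‖boundaryPoint x - y‖ₑ ≠ 0 := by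
  rw [Ne, enorm_eq_zero, sub_eq_zero]
  rintro rfl
  simp [halfSpace] at hy

/-- The half-ball of radius `r` centred at a boundary point of the half-space. -/
def halfBall (x : EuclideanSpace ℝ (Fin d)) (r : ℝ) : Set (EuclideanSpace ℝ (Fin (d + 1))) :=
  Metric.ball (boundaryPoint x) r ∩ halfSpace d

theorem measurableSet_halfBall (x : EuclideanSpace ℝ (Fin d)) (r : ℝ) :
    MeasurableSet (halfBall x r) :=
  measurableSet_ball.inter measurableSet_halfSpace

theorem halfBall_mono (x : EuclideanSpace ℝ (Fin d)) {r r' : ℝ} (h : r ≤ r') :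
    halfBall x r ⊆ halfBall x r' :=
  Set.inter_subset_inter_left _ (Metric.ball_subset_ball h)

theorem halfBall_subset_halfSpace (x : EuclideanSpace ℝ (Fin d)) (r : ℝ) :
    halfBall x r ⊆ halfSpace d := Set.inter_subset_right

/-- The volume of the unit half-ball. -/
noncomputable def unitHalfBallVolume (d : ℕ) : ℝ≥0∞ :=
  volume (Metric.ball (0 : EuclideanSpace ℝ (Fin (d + 1))) 1 ∩ halfSpace d)

theorem unitHalfBallVolume_ne_top : unitHalfBallVolume d ≠ ∞ :=
  ((measure_mono Set.inter_subset_left).trans_lt measure_ball_lt_top).ne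

theorem unitHalfBallVolume_ne_zero : unitHalfBallVolume d ≠ 0 := by
  refine ((Metric.isOpen_ball.inter isOpen_halfSpace).measure_pos _
    ⟨EuclideanSpace.single (Fin.last d) (1 / 2), ?_, ?_⟩).ne'
  · simp; norm_num
  · simp [halfSpace]

/-- The half-space is invariant under positive dilations and under translations along its boundary.
-/
theorem volume_halfBall (x : EuclideanSpace ℝ (Fin d)) {r : ℝ} (hr : 0 < r) :
    volume (halfBall x r) = ENNReal.ofReal r ^ (d + 1) * unitHalfBallVolume d := by
  have h1 : (fun y => r • y) ⁻¹' ((fun y => boundaryPoint x + y) ⁻¹' halfBall x r) =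
      Metric.ball (0 : EuclideanSpace ℝ (Fin (d + 1))) 1 ∩ halfSpace d := by
    ext y
    have : r * ‖y‖ < r ↔ ‖y‖ < 1 := by
      constructor <;> intro h <;> nlinarith
    simp [halfBall, halfSpace, norm_smul, abs_of_pos hr, hr, this]
  have h2 := Measure.addHaar_preimage_smul volume hr.ne'
    ((fun y => boundaryPoint x + y) ⁻¹' halfBall x r)
  rw [h1, measure_preimage_add, finrank_euclideanSpace_fin,
    abs_of_pos (inv_pos.2 (pow_pos hr _)), ENNReal.ofReal_inv_of_pos (pow_pos hr _),
    ENNReal.ofReal_pow hr.le] at h2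
  rw [unitHalfBallVolume, h2, ← mul_assoc, ENNReal.mul_inv_cancel (by simp [hr]) (by simp), one_mul]

/-- Dropping the last coordinate does not increase distances, so the slice lies in a ball of the
same radius around the projection of `y`. -/
theorem volume_preimage_boundaryPoint_ball_le (y : EuclideanSpace ℝ (Fin (d + 1))) {r : ℝ}
    (hr : 0 < r) :
    volume (boundaryPoint ⁻¹' Metric.ball y r) ≤
      ENNReal.ofReal r ^ d * volume (Metric.ball (0 : EuclideanSpace ℝ (Fin d)) 1) := by
  have h : boundaryPoint ⁻¹' Metric.ball y r ⊆
      Metric.ball (WithLp.toLp 2 fun i => y (Fin.castSucc i)) r := by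
    intro x hx
    refine lt_of_le_of_lt ?_ (Metric.mem_ball.1 hx)
    rw [EuclideanSpace.dist_eq, EuclideanSpace.dist_eq, Fin.sum_univ_castSucc]
    refine Real.sqrt_le_sqrt ?_
    simpa using sq_nonneg _
  refine (measure_mono h).trans_eq ?_
  rw [Measure.addHaar_ball_of_pos _ _ hr, finrank_euclideanSpace_fin, ENNReal.ofReal_pow hr.le]

/-- The dyadic radius `2 ^ (-k)`. -/
noncomputable def dyadicRadius (k : ℤ) : ℝ := 2 ^ (-(k : ℝ))

theorem dyadicRadius_pos (k : ℤ) : 0 < dyadicRadius k := Real.rpow_pos_of_pos two_pos _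

theorem dyadicRadius_succ_le (k : ℤ) : dyadicRadius (k + 1) ≤ dyadicRadius k :=
  Real.rpow_le_rpow_of_exponent_le one_le_two (by push_cast; linarith)

theorem ofReal_dyadicRadius (k : ℤ) :
    ENNReal.ofReal (dyadicRadius k) = 2 ^ (-(k : ℝ)) := by
  rw [dyadicRadius, ← ENNReal.ofReal_rpow_of_pos two_pos]; simp

theorem volume_halfBall_dyadicRadius (x : EuclideanSpace ℝ (Fin d)) (k : ℤ) :
    volume (halfBall x (dyadicRadius k)) =
      2 ^ (-(k : ℝ) * ((d + 1 : ℕ) : ℝ)) * unitHalfBallVolume d := by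
  rw [volume_halfBall x (dyadicRadius_pos k), ofReal_dyadicRadius, ENNReal.rpow_mul,
    ENNReal.rpow_natCast]

theorem mem_ball_iff_enorm_lt {E : Type*} [SeminormedAddCommGroup E] {x y : E} {r : ℝ} :
    y ∈ Metric.ball x r ↔ ‖x - y‖ₑ < ENNReal.ofReal r := by
  rw [Metric.mem_ball', dist_eq_norm, ← ofReal_norm, ENNReal.ofReal_lt_ofReal_iff']
  exact ⟨fun h => ⟨h, (norm_nonneg _).trans_lt h⟩, And.left⟩

theorem mem_halfBall_dyadicRadius {x : EuclideanSpace ℝ (Fin d)}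
    {y : EuclideanSpace ℝ (Fin (d + 1))} {k : ℤ} :
    y ∈ halfBall x (dyadicRadius k) ↔ ‖boundaryPoint x - y‖ₑ < 2 ^ (-(k : ℝ)) ∧ y ∈ halfSpace d := by
  rw [halfBall, Set.mem_inter_iff, mem_ball_iff_enorm_lt, ofReal_dyadicRadius]

theorem volume_halfBall_ne_zero (x : EuclideanSpace ℝ (Fin d)) {r : ℝ} (hr : 0 < r) :
    volume (halfBall x r) ≠ 0 := by
  rw [volume_halfBall x hr]
  exact mul_ne_zero (by simp [hr]) unitHalfBallVolume_ne_zero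

theorem volume_halfBall_ne_top (x : EuclideanSpace ℝ (Fin d)) (r : ℝ) :
    volume (halfBall x r) ≠ ∞ :=
  ((measure_mono Set.inter_subset_left).trans_lt measure_ball_lt_top).ne

/-- The indicator function of the open neighbourhood of size `2 ^ (-k)` of the pairs `(x, y)` with
`y = (x, 0)`. -/
noncomputable def nearIndicator (k : ℤ) (x : EuclideanSpace ℝ (Fin d))
    (y : EuclideanSpace ℝ (Fin (d + 1))) : ℝ≥0∞ :=
  {q : EuclideanSpace ℝ (Fin d) × EuclideanSpace ℝ (Fin (d + 1)) |
    ‖boundaryPoint q.1 - q.2‖ₑ < 2 ^ (-(k : ℝ))}.indicator 1 (x, y)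

theorem measurable_nearIndicator (k : ℤ) :
    Measurable fun q : EuclideanSpace ℝ (Fin d) × EuclideanSpace ℝ (Fin (d + 1)) =>
      nearIndicator k q.1 q.2 :=
  measurable_one.indicator (measurableSet_lt (by fun_prop) measurable_const)

theorem setLIntegral_halfBall_dyadicRadius (x : EuclideanSpace ℝ (Fin d)) (k : ℤ)
    (f : EuclideanSpace ℝ (Fin (d + 1)) → ℝ≥0∞) :
    ∫⁻ y in halfBall x (dyadicRadius k), f y = ∫⁻ y in halfSpace d, nearIndicator k x y * f y := by
  rw [halfBall, ← Measure.restrict_restrict measurableSet_ball,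
    ← lintegral_indicator measurableSet_ball]
  congr with y
  classical
  rw [Set.indicator_apply, mem_ball_iff_enorm_lt, ofReal_dyadicRadius]
  simp [nearIndicator, Set.indicator_apply]

theorem lintegral_nearIndicator_le (k : ℤ) (y : EuclideanSpace ℝ (Fin (d + 1))) :
    ∫⁻ x, nearIndicator k x y ≤
      2 ^ (-(k : ℝ) * d) * volume (Metric.ball (0 : EuclideanSpace ℝ (Fin d)) 1) := by
  have h := volume_preimage_boundaryPoint_ball_le y (dyadicRadius_pos k)
  rw [ofReal_dyadicRadius, ← ENNReal.rpow_natCast, ← ENNReal.rpow_mul] at h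
  refine le_trans (le_of_eq ?_) h
  rw [← lintegral_indicator_one (measurable_boundaryPoint measurableSet_ball)]
  congr with x
  have hx : boundaryPoint x ∈ Metric.ball y (dyadicRadius k) ↔
      ‖boundaryPoint x - y‖ₑ < 2 ^ (-(k : ℝ)) := by
    rw [Metric.mem_ball_comm, mem_ball_iff_enorm_lt, ofReal_dyadicRadius]
  classical
  rw [nearIndicator, Set.indicator_apply, Set.indicator_apply, Set.mem_preimage, hx]
  simp

/-- If `y` and `z` are both within `2 ^ (-k)` of `x`, they are within twice that of each other. This
condition no longer involves `x`, which frees the integration in `x`. -/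
theorem nearIndicator_mul_le (k : ℤ) (x : EuclideanSpace ℝ (Fin d))
    (y z : EuclideanSpace ℝ (Fin (d + 1))) :
    nearIndicator k x y * nearIndicator k x z ≤
      {k : ℤ | ‖y - z‖ₑ / 2 < (2 : ℝ≥0∞) ^ (-(k : ℝ))}.indicator 1 k * nearIndicator k x y := by
  by_cases hy : ‖boundaryPoint x - y‖ₑ < 2 ^ (-(k : ℝ))
  swap
  · simp [nearIndicator, Set.indicator_apply, hy]
  by_cases hz : ‖boundaryPoint x - z‖ₑ < 2 ^ (-(k : ℝ))
  swap
  · simp [nearIndicator, Set.indicator_apply, hz]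
  have h : ‖y - z‖ₑ / 2 < 2 ^ (-(k : ℝ)) := by
    rw [ENNReal.div_lt_iff (by simp) (by simp), mul_two]
    refine lt_of_le_of_lt ?_ (ENNReal.add_lt_add hz hy)
    calc ‖y - z‖ₑ = ‖(boundaryPoint x - z) - (boundaryPoint x - y)‖ₑ := by congr 1; abel
      _ ≤ _ := enorm_sub_le
  simp [nearIndicator, hy, hz, h]

end HalfBall

/-! ### Interchange of integrals and sums -/

theorem lintegral_lintegral_lintegral_rotate {α β γ : Type*} [MeasurableSpace α]
    [MeasurableSpace β] [MeasurableSpace γ] {μ : Measure α} {ν : Measure β} {ρ : Measure γ}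
    [SFinite μ] [SFinite ν] [SFinite ρ] {f : α → β → γ → ℝ≥0∞}
    (hf : Measurable fun q : (α × β) × γ => f q.1.1 q.1.2 q.2) :
    ∫⁻ x, ∫⁻ y, ∫⁻ z, f x y z ∂ρ ∂ν ∂μ = ∫⁻ y, ∫⁻ z, ∫⁻ x, f x y z ∂μ ∂ρ ∂ν := by
  have h1 : Measurable (Function.uncurry fun x y => ∫⁻ z, f x y z ∂ρ) := hf.lintegral_prod_right'
  rw [lintegral_lintegral_swap h1.aemeasurable]
  congr with y
  have h2 : Measurable (Function.uncurry fun x z => f x y z) :=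
    hf.comp (by fun_prop : Measurable fun q : α × γ => ((q.1, y), q.2))
  exact lintegral_lintegral_swap h2.aemeasurable

theorem tsum_lintegral_lintegral {ι α β : Type*} [Countable ι] [MeasurableSpace α]
    [MeasurableSpace β] {μ : Measure α} {ν : Measure β} [SFinite ν] {f : ι → α → β → ℝ≥0∞}
    (hf : ∀ i, Measurable (Function.uncurry (f i))) :
    ∑' i, ∫⁻ x, ∫⁻ y, f i x y ∂ν ∂μ = ∫⁻ x, ∫⁻ y, ∑' i, f i x y ∂ν ∂μ := by
  have h1 : ∀ i, Measurable fun x => ∫⁻ y, f i x y ∂ν := fun i => (hf i).lintegral_prod_right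
  rw [← lintegral_tsum fun i => (h1 i).aemeasurable]
  congr with x
  exact (lintegral_tsum fun i => (hf i).of_uncurry_left.aemeasurable).symm

/-! ### Dyadic oscillations and their control by the Gagliardo integral -/

section Oscillation

variable {d : ℕ} {p : ℝ} {u : EuclideanSpace ℝ (Fin (d + 1)) → ℝ}

/-- The unnormalized `p`-oscillation of `u` on the half-ball of radius `2 ^ (-k)` centred at `x`. -/
noncomputable def dyadicOscillation (p : ℝ) (u : EuclideanSpace ℝ (Fin (d + 1)) → ℝ)
    (x : EuclideanSpace ℝ (Fin d)) (k : ℤ) : ℝ≥0∞ :=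
  ∫⁻ y in halfBall x (dyadicRadius k), ∫⁻ z in halfBall x (dyadicRadius k), ‖u y - u z‖ₑ ^ p

/-- The sum over all dyadic scales of the weighted `p`-oscillations of `u` around `x`. -/
noncomputable def oscillationSum (s p : ℝ) (u : EuclideanSpace ℝ (Fin (d + 1)) → ℝ)
    (x : EuclideanSpace ℝ (Fin d)) : ℝ≥0∞ :=
  ∑' k : ℤ, 2 ^ (k * (2 * ((d + 1 : ℕ) : ℝ) + s * p - 1)) * dyadicOscillation p u x k

/-- The mean of `u` on the half-ball of radius `2 ^ (-k)` centred at `x`. -/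
noncomputable def dyadicMean (u : EuclideanSpace ℝ (Fin (d + 1)) → ℝ)
    (x : EuclideanSpace ℝ (Fin d)) (k : ℤ) : ℝ :=
  ⨍ y in halfBall x (dyadicRadius k), u y

theorem dyadicOscillation_eq (x : EuclideanSpace ℝ (Fin d)) (k : ℤ) :
    dyadicOscillation p u x k = ∫⁻ y in halfSpace d, ∫⁻ z in halfSpace d,
      nearIndicator k x y * (nearIndicator k x z * ‖u y - u z‖ₑ ^ p) := by
  rw [dyadicOscillation, setLIntegral_halfBall_dyadicRadius]
  congr with y
  rw [setLIntegral_halfBall_dyadicRadius, lintegral_const_mul' _ _ ?_]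
  refine ne_of_lt (lt_of_le_of_lt ?_ ENNReal.one_lt_top)
  exact Set.indicator_le_self' (by simp) _

theorem measurable_nearIndicator_mul (hu : Measurable u) (k : ℤ) :
    Measurable fun q : (EuclideanSpace ℝ (Fin d) × EuclideanSpace ℝ (Fin (d + 1))) ×
      EuclideanSpace ℝ (Fin (d + 1)) =>
      nearIndicator k q.1.1 q.1.2 * (nearIndicator k q.1.1 q.2 * ‖u q.1.2 - u q.2‖ₑ ^ p) := by
  have h1 := (measurable_nearIndicator (d := d) k).comp
    (measurable_fst : Measurable fun q : (EuclideanSpace ℝ (Fin d) ×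
      EuclideanSpace ℝ (Fin (d + 1))) × EuclideanSpace ℝ (Fin (d + 1)) => q.1)
  have h2 := (measurable_nearIndicator (d := d) k).comp
    (by fun_prop : Measurable fun q : (EuclideanSpace ℝ (Fin d) ×
      EuclideanSpace ℝ (Fin (d + 1))) × EuclideanSpace ℝ (Fin (d + 1)) => (q.1.1, q.2))
  exact h1.mul (h2.mul (by fun_prop))

theorem measurable_dyadicOscillation (hu : Measurable u) (k : ℤ) :
    Measurable fun x : EuclideanSpace ℝ (Fin d) => dyadicOscillation p u x k := by
  simp_rw [dyadicOscillation_eq]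
  exact ((measurable_nearIndicator_mul hu k).lintegral_prod_right').lintegral_prod_right'

theorem measurable_oscillationSum (hu : Measurable u) (s : ℝ) :
    Measurable fun x : EuclideanSpace ℝ (Fin d) => oscillationSum s p u x :=
  Measurable.tsum fun k => (measurable_dyadicOscillation hu k).const_mul _

theorem measurable_nearIndicator_left (k : ℤ) (y : EuclideanSpace ℝ (Fin (d + 1))) :
    Measurable fun x : EuclideanSpace ℝ (Fin d) => nearIndicator k x y := by
  have h := (measurable_nearIndicator (d := d) k).comp (measurable_prodMk_right (y := y))
  exact h

theorem lintegral_nearIndicator_mul_le (k : ℤ) (y z : EuclideanSpace ℝ (Fin (d + 1))) :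
    ∫⁻ x, nearIndicator k x y * nearIndicator k x z ≤
      {k : ℤ | ‖y - z‖ₑ / 2 < (2 : ℝ≥0∞) ^ (-(k : ℝ))}.indicator
          (fun k => 2 ^ (-(k : ℝ) * d)) k *
        volume (Metric.ball (0 : EuclideanSpace ℝ (Fin d)) 1) := by
  refine (lintegral_mono fun x => nearIndicator_mul_le k x y z).trans ?_
  rw [lintegral_const_mul _ (measurable_nearIndicator_left k y)]
  refine (mul_le_mul_right (lintegral_nearIndicator_le k y) _).trans_eq ?_
  rw [← mul_assoc]
  congr 1
  by_cases h : ‖y - z‖ₑ / 2 < (2 : ℝ≥0∞) ^ (-(k : ℝ)) <;> simp [h]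

theorem lintegral_dyadicOscillation_le (hu : Measurable u) (k : ℤ) :
    ∫⁻ x, dyadicOscillation p u x k ≤
      ∫⁻ y in halfSpace d, ∫⁻ z in halfSpace d,
        {k : ℤ | ‖y - z‖ₑ / 2 < (2 : ℝ≥0∞) ^ (-(k : ℝ))}.indicator
          (fun k => 2 ^ (-(k : ℝ) * d)) k *
        (volume (Metric.ball (0 : EuclideanSpace ℝ (Fin d)) 1) * ‖u y - u z‖ₑ ^ p) := by
  have hm := measurable_nearIndicator_mul (p := p) hu k
  simp_rw [dyadicOscillation_eq]
  rw [lintegral_lintegral_lintegral_rotate hm]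
  refine lintegral_mono fun y => lintegral_mono fun z => ?_
  have h := lintegral_nearIndicator_mul_le k y z
  have hyz := (measurable_nearIndicator_left k y).mul (measurable_nearIndicator_left k z)
  calc ∫⁻ x, nearIndicator k x y * (nearIndicator k x z * ‖u y - u z‖ₑ ^ p)
      = ∫⁻ x, nearIndicator k x y * nearIndicator k x z * ‖u y - u z‖ₑ ^ p := by
        simp_rw [mul_assoc]
    _ = (∫⁻ x, nearIndicator k x y * nearIndicator k x z) * ‖u y - u z‖ₑ ^ p :=
        lintegral_mul_const _ hyz
    _ ≤ _ := (mul_le_mul_left h _).trans_eq (mul_assoc _ _ _)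

theorem lintegral_oscillationSum_le (d : ℕ) {s p : ℝ} (hs : 0 < s) (hp : 1 ≤ p) :
    ∃ C : ℝ≥0∞, C ≠ ∞ ∧ ∀ u : EuclideanSpace ℝ (Fin (d + 1)) → ℝ, Measurable u →
      ∫⁻ x, oscillationSum s p u x ≤ C * gagliardoIntegral d s p u := by
  set N : ℝ := ((d + 1 : ℕ) : ℝ) with hN
  have hα : 0 < N + s * p := by positivity
  set W := ∑' i : ℕ, (2 : ℝ≥0∞) ^ (-(i * (N + s * p))) with hW
  set V := volume (Metric.ball (0 : EuclideanSpace ℝ (Fin d)) 1) with hV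
  have hW' : W ≠ ∞ := (ENNReal.tsum_two_rpow_neg_lt_top hα).ne
  have hV' : V ≠ ∞ := measure_ball_lt_top.ne
  have hC : W * 2 ^ (N + s * p) * V ≠ ∞ :=
    ENNReal.mul_ne_top (ENNReal.mul_ne_top hW' (ENNReal.two_rpow_ne_top _)) hV'
  refine ⟨_, hC, fun u hu => ?_⟩
  have hind : ∀ k : ℤ, Measurable fun q : EuclideanSpace ℝ (Fin (d + 1)) ×
      EuclideanSpace ℝ (Fin (d + 1)) => {k : ℤ | ‖q.1 - q.2‖ₑ / 2 < (2 : ℝ≥0∞) ^ (-(k : ℝ))}.indicator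
        (fun k => (2 : ℝ≥0∞) ^ (k * (N + s * p))) k := fun k => by
    have : MeasurableSet {q : EuclideanSpace ℝ (Fin (d + 1)) × EuclideanSpace ℝ (Fin (d + 1)) |
        ‖q.1 - q.2‖ₑ / 2 < (2 : ℝ≥0∞) ^ (-(k : ℝ))} :=
      measurableSet_lt (by fun_prop) measurable_const
    exact (measurable_const (a := (2 : ℝ≥0∞) ^ (k * (N + s * p)))).indicator this
  have hmeas : ∀ k : ℤ, Measurable (Function.uncurry fun y z : EuclideanSpace ℝ (Fin (d + 1)) =>
      {k : ℤ | ‖y - z‖ₑ / 2 < (2 : ℝ≥0∞) ^ (-(k : ℝ))}.indicator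
        (fun k => (2 : ℝ≥0∞) ^ (k * (N + s * p))) k * (V * ‖u y - u z‖ₑ ^ p)) := fun k =>
    (hind k).mul (by fun_prop)
  calc ∫⁻ x, oscillationSum s p u x
      = ∑' k : ℤ, 2 ^ (k * (2 * N + s * p - 1)) * ∫⁻ x, dyadicOscillation p u x k := by
        unfold oscillationSum
        rw [lintegral_tsum fun k => ((measurable_dyadicOscillation hu k).const_mul _).aemeasurable]
        simp_rw [lintegral_const_mul _ (measurable_dyadicOscillation hu _)]
        rfl
    _ ≤ ∑' k : ℤ, ∫⁻ y in halfSpace d, ∫⁻ z in halfSpace d,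
          {k : ℤ | ‖y - z‖ₑ / 2 < (2 : ℝ≥0∞) ^ (-(k : ℝ))}.indicator
            (fun k => (2 : ℝ≥0∞) ^ (k * (N + s * p))) k * (V * ‖u y - u z‖ₑ ^ p) := by
        refine ENNReal.tsum_le_tsum fun k =>
          (mul_le_mul_right (lintegral_dyadicOscillation_le hu k) _).trans_eq ?_
        rw [← lintegral_const_mul' _ _ (ENNReal.two_rpow_ne_top _)]
        congr with y
        rw [← lintegral_const_mul' _ _ (ENNReal.two_rpow_ne_top _)]
        congr with z
        rw [← mul_assoc]
        congr 1
        by_cases h : ‖y - z‖ₑ / 2 < (2 : ℝ≥0∞) ^ (-(k : ℝ))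
        · simp only [Set.indicator_apply, Set.mem_ofPred_eq, h, if_true]
          -- With `d = N - 1`, the exponents add up to `k (2N + sp - 1) - k (N - 1) = k (N + sp)`.
          rw [ENNReal.two_rpow_mul_two_rpow]
          congr 1
          rw [hN]; push_cast; ring
        · simp [h]
    _ = ∫⁻ y in halfSpace d, ∫⁻ z in halfSpace d,
          dyadicKernel (N + s * p) (‖y - z‖ₑ / 2) * (V * ‖u y - u z‖ₑ ^ p) := by
        rw [tsum_lintegral_lintegral hmeas]
        congr with y
        congr with z
        rw [ENNReal.tsum_mul_right]
        rfl
    _ ≤ ∫⁻ y in halfSpace d, ∫⁻ z in halfSpace d,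
          W * 2 ^ (N + s * p) * V * (‖u y - u z‖ₑ ^ p / ‖y - z‖ₑ ^ (N + s * p)) := by
        refine lintegral_mono fun y => lintegral_mono fun z => ?_
        refine (mul_le_mul_left (dyadicKernel_le hα _) _).trans_eq ?_
        -- The factor `2 ^ (N + s * p)` comes from evaluating the kernel at `‖y - z‖ₑ / 2`.
        rw [ENNReal.rpow_neg, ENNReal.div_rpow_of_nonneg _ _ hα.le,
          ENNReal.inv_div (by simp) (by simp),
          ENNReal.div_eq_inv_mul, ENNReal.div_eq_inv_mul]
        ring
    _ = _ := by
        simp_rw [lintegral_const_mul' _ _ hC]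
        rfl

end Oscillation

/-! ### Estimates at a boundary point with finite oscillation sum -/

section Pointwise

variable {d : ℕ} {s p : ℝ} {u : EuclideanSpace ℝ (Fin (d + 1)) → ℝ}

theorem isFiniteMeasure_restrict_halfBall (x : EuclideanSpace ℝ (Fin d)) (r : ℝ) :
    IsFiniteMeasure (volume.restrict (halfBall x r)) :=
  isFiniteMeasure_restrict.2 (volume_halfBall_ne_top x r)

theorem neZero_restrict_halfBall (x : EuclideanSpace ℝ (Fin d)) {r : ℝ} (hr : 0 < r) :
    NeZero (volume.restrict (halfBall x r)) :=
  ⟨by simpa using volume_halfBall_ne_zero x hr⟩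

theorem inv_volume_halfBall_dyadicRadius (x : EuclideanSpace ℝ (Fin d)) (k : ℤ) :
    (volume (halfBall x (dyadicRadius k)))⁻¹ =
      2 ^ ((k : ℝ) * ((d + 1 : ℕ) : ℝ)) * (unitHalfBallVolume d)⁻¹ := by
  rw [volume_halfBall_dyadicRadius, ENNReal.mul_inv (Or.inl (ENNReal.two_rpow_ne_zero _))
    (Or.inl (ENNReal.two_rpow_ne_top _)), ← ENNReal.rpow_neg, neg_mul, neg_neg]

theorem integrableOn_halfBall_dyadicRadius (hp : 1 ≤ p) (hu : Measurable u)
    {x : EuclideanSpace ℝ (Fin d)} {k : ℤ} (h : dyadicOscillation p u x k ≠ ∞) :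
    Integrable u (volume.restrict (halfBall x (dyadicRadius k))) := by
  have := isFiniteMeasure_restrict_halfBall x (dyadicRadius k)
  have := neZero_restrict_halfBall x (dyadicRadius_pos k)
  exact integrable_of_lintegral_enorm_sub_rpow hp hu.aestronglyMeasurable h

theorem lintegral_enorm_sub_dyadicMean_le (hp : 1 ≤ p) (hu : Measurable u)
    {x : EuclideanSpace ℝ (Fin d)} {k : ℤ} (h : dyadicOscillation p u x k ≠ ∞) :
    ∫⁻ y in halfBall x (dyadicRadius k), ‖u y - dyadicMean u x k‖ₑ ^ p ≤
      (volume (halfBall x (dyadicRadius k)))⁻¹ * dyadicOscillation p u x k := by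
  have := isFiniteMeasure_restrict_halfBall x (dyadicRadius k)
  have := neZero_restrict_halfBall x (dyadicRadius_pos k)
  have hi := integrableOn_halfBall_dyadicRadius hp hu h
  rw [dyadicOscillation, ← lintegral_const_mul' _ _
    (ENNReal.inv_ne_top.2 (volume_halfBall_ne_zero x (dyadicRadius_pos k)))]
  refine lintegral_mono fun y => ?_
  simpa [dyadicMean] using enorm_sub_average_rpow_le hp hi (u y)

/-- Jensen on the smaller half-ball, enlargement of the domain to the larger one, then Jensen there.
Each step costs one inverse volume, whence `2 ^ (2kN)`; the extra `2 ^ N` is the ratio of the two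
volumes. -/
theorem enorm_dyadicMean_sub_succ_rpow_le (hp : 1 ≤ p) (hu : Measurable u)
    {x : EuclideanSpace ℝ (Fin d)} {k : ℤ} (h : dyadicOscillation p u x k ≠ ∞) :
    ‖dyadicMean u x k - dyadicMean u x (k + 1)‖ₑ ^ p ≤
      2 ^ ((d + 1 : ℕ) : ℝ) * (unitHalfBallVolume d)⁻¹ ^ 2 *
        (2 ^ (2 * k * ((d + 1 : ℕ) : ℝ)) * dyadicOscillation p u x k) := by
  have := isFiniteMeasure_restrict_halfBall x (dyadicRadius (k + 1))
  have := neZero_restrict_halfBall x (dyadicRadius_pos (k + 1))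
  have hsub := halfBall_mono x (dyadicRadius_succ_le k)
  have hi : Integrable u (volume.restrict (halfBall x (dyadicRadius (k + 1)))) :=
    IntegrableOn.mono_set (integrableOn_halfBall_dyadicRadius hp hu h) hsub
  calc ‖dyadicMean u x k - dyadicMean u x (k + 1)‖ₑ ^ p
      ≤ (volume (halfBall x (dyadicRadius (k + 1))))⁻¹ *
        ∫⁻ y in halfBall x (dyadicRadius (k + 1)), ‖dyadicMean u x k - u y‖ₑ ^ p := by
        simpa [dyadicMean] using enorm_sub_average_rpow_le hp hi (dyadicMean u x k)
    _ ≤ (volume (halfBall x (dyadicRadius (k + 1))))⁻¹ *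
        ((volume (halfBall x (dyadicRadius k)))⁻¹ * dyadicOscillation p u x k) := by
        gcongr
        refine (lintegral_mono_set hsub).trans ?_
        simp_rw [enorm_sub_rev (dyadicMean u x k)]
        exact lintegral_enorm_sub_dyadicMean_le hp hu h
    _ = _ := by
        rw [inv_volume_halfBall_dyadicRadius, inv_volume_halfBall_dyadicRadius]
        have : (2 : ℝ≥0∞) ^ (((k + 1 : ℤ) : ℝ) * ((d + 1 : ℕ) : ℝ)) *
            2 ^ ((k : ℝ) * ((d + 1 : ℕ) : ℝ)) =
            2 ^ ((d + 1 : ℕ) : ℝ) * 2 ^ (2 * k * ((d + 1 : ℕ) : ℝ)) := by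
          rw [ENNReal.two_rpow_mul_two_rpow, ENNReal.two_rpow_mul_two_rpow]
          congr 1
          push_cast; ring
        refine Eq.trans ?_ ((congrArg (· * ((unitHalfBallVolume d)⁻¹ ^ 2 *
          dyadicOscillation p u x k)) this).trans ?_) <;> ring

theorem dyadicOscillation_ne_top {x : EuclideanSpace ℝ (Fin d)}
    (h : oscillationSum s p u x ≠ ∞) (k : ℤ) : dyadicOscillation p u x k ≠ ∞ := by
  intro hk
  refine ENNReal.ne_top_of_tsum_ne_top h k ?_
  rw [hk, ENNReal.mul_top (ENNReal.two_rpow_ne_zero _)]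

/-- Weighted Jensen with `ε = (sp - 1) / p`. This choice spends only part of the gain `2 ^ (-(i (sp
- 1)))` between scales `k` and `k + i`, and leaves a factor `2 ^ (-(i ε))` that is summable in `i`
when `sp > 1`. -/
theorem two_rpow_mul_tsum_enorm_sub_rpow_le (hp : 1 ≤ p) (hu : Measurable u)
    {x : EuclideanSpace ℝ (Fin d)} (h : oscillationSum s p u x ≠ ∞) (k : ℤ) :
    (2 : ℝ≥0∞) ^ (k * (s * p - 1)) *
        (∑' i : ℕ, ‖dyadicMean u x (k + i) - dyadicMean u x (k + i + 1)‖ₑ) ^ p ≤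
      (∑' i : ℕ, (2 : ℝ≥0∞) ^ (-(i * ((s * p - 1) / p)))) ^ (p - 1) *
        (2 ^ ((d + 1 : ℕ) : ℝ) * (unitHalfBallVolume d)⁻¹ ^ 2) *
        ∑' i : ℕ, 2 ^ (-(i * ((s * p - 1) / p))) *
          (2 ^ ((k + i : ℤ) * (2 * ((d + 1 : ℕ) : ℝ) + s * p - 1)) *
            dyadicOscillation p u x (k + i)) := by
  have hp0 : p ≠ 0 := by positivity
  refine (mul_le_mul_right (ENNReal.tsum_rpow_le_weighted hp ((s * p - 1) / p) _) _).trans ?_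
  rw [mul_left_comm, mul_assoc]
  refine mul_le_mul_right ?_ _
  rw [← ENNReal.tsum_mul_left, ← ENNReal.tsum_mul_left]
  refine ENNReal.tsum_le_tsum fun i => ?_
  refine (mul_le_mul_right (mul_le_mul_right (enorm_dyadicMean_sub_succ_rpow_le hp hu
    (dyadicOscillation_ne_top h (k + i))) _) _).trans_eq ?_
  have : (2 : ℝ≥0∞) ^ (k * (s * p - 1)) * (2 ^ (i * ((s * p - 1) / p) * (p - 1)) *
      2 ^ (2 * (k + i : ℤ) * ((d + 1 : ℕ) : ℝ))) = 2 ^ (-(i * ((s * p - 1) / p))) *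
      2 ^ ((k + i : ℤ) * (2 * ((d + 1 : ℕ) : ℝ) + s * p - 1)) := by
    rw [ENNReal.two_rpow_mul_two_rpow, ENNReal.two_rpow_mul_two_rpow,
      ENNReal.two_rpow_mul_two_rpow]
    congr 1
    push_cast
    field_simp
    ring
  refine Eq.trans ?_ ((congrArg (· * (2 ^ ((d + 1 : ℕ) : ℝ) * (unitHalfBallVolume d)⁻¹ ^ 2 *
    dyadicOscillation p u x (k + i))) this).trans ?_) <;> ring

/-- The constant in the bound of the dyadic increments by the oscillations. -/
noncomputable def incrementConst (d : ℕ) (s p : ℝ) : ℝ≥0∞ :=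
  (∑' i : ℕ, (2 : ℝ≥0∞) ^ (-(i * ((s * p - 1) / p)))) ^ (p - 1) *
    (2 ^ ((d + 1 : ℕ) : ℝ) * (unitHalfBallVolume d)⁻¹ ^ 2) *
    ∑' i : ℕ, (2 : ℝ≥0∞) ^ (-(i * ((s * p - 1) / p)))

theorem incrementConst_ne_top (d : ℕ) (hp : 1 ≤ p) (hsp : 1 < s * p) :
    incrementConst d s p ≠ ∞ := by
  have hW := (ENNReal.tsum_two_rpow_neg_lt_top (ε := (s * p - 1) / p)
    (div_pos (by linarith) (by linarith))).ne
  refine ENNReal.mul_ne_top (ENNReal.mul_ne_top ?_ (ENNReal.mul_ne_top ?_ ?_)) hW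
  · exact ENNReal.rpow_ne_top_of_nonneg (by linarith) hW
  · exact ENNReal.two_rpow_ne_top _
  · exact ENNReal.pow_ne_top (ENNReal.inv_ne_top.2 unitHalfBallVolume_ne_zero)

/-- A discrete Hardy inequality: after exchanging the sums, each fixed `i` gives the whole
oscillation sum with the coefficient `2 ^ (-(i ε))`. -/
theorem tsum_two_rpow_mul_tsum_enorm_sub_rpow_le (hp : 1 ≤ p) (hu : Measurable u)
    {x : EuclideanSpace ℝ (Fin d)} (h : oscillationSum s p u x ≠ ∞) :
    ∑' k : ℤ, (2 : ℝ≥0∞) ^ (k * (s * p - 1)) *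
        (∑' i : ℕ, ‖dyadicMean u x (k + i) - dyadicMean u x (k + i + 1)‖ₑ) ^ p ≤
      incrementConst d s p * oscillationSum s p u x := by
  refine (ENNReal.tsum_le_tsum fun k => two_rpow_mul_tsum_enorm_sub_rpow_le hp hu h k).trans ?_
  rw [ENNReal.tsum_mul_left, ENNReal.tsum_comm, incrementConst,
    mul_assoc _ _ (oscillationSum s p u x)]
  refine mul_le_mul_right (le_of_eq ?_) _
  rw [← ENNReal.tsum_mul_right]
  congr with i
  rw [ENNReal.tsum_mul_left, oscillationSum]
  congr 1
  -- The scales range over all of `ℤ`, so the shift by `i` loses nothing.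
  exact (Equiv.addRight (i : ℤ)).tsum_eq fun k : ℤ =>
    (2 : ℝ≥0∞) ^ (k * (2 * ((d + 1 : ℕ) : ℝ) + s * p - 1)) * dyadicOscillation p u x k

theorem exists_tendsto_dyadicMean (hp : 1 ≤ p) (hsp : 1 < s * p) (hu : Measurable u)
    {x : EuclideanSpace ℝ (Fin d)} (h : oscillationSum s p u x ≠ ∞) :
    ∃ l, Tendsto (dyadicMean u x) atTop (𝓝 l) := by
  have h1 := ne_top_of_le_ne_top (ENNReal.mul_ne_top (incrementConst_ne_top d hp hsp) h)
    (tsum_two_rpow_mul_tsum_enorm_sub_rpow_le hp hu h)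
  -- The term `k = 0` has weight one and already says that the increments are summable.
  have h2 := ENNReal.ne_top_of_tsum_ne_top h1 0
  have h3 : ∑' i : ℕ, ‖dyadicMean u x i - dyadicMean u x (i + 1)‖ₑ ≠ ∞ := by
    intro h4
    simp [h4, ENNReal.top_rpow_of_pos (zero_lt_one.trans_le hp)] at h2
  obtain ⟨l, hl⟩ := cauchySeq_tendsto_of_complete (cauchySeq_of_edist_le_of_tsum_ne_top
    (f := fun i : ℕ => dyadicMean u x i) _ (fun i => by
      rw [edist_eq_enorm_sub]; push_cast; exact le_rfl) h3)
  refine ⟨l, ?_⟩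
  rw [← Nat.map_cast_int_atTop, tendsto_map'_iff]
  exact hl

theorem enorm_sub_dyadicMean_le {x : EuclideanSpace ℝ (Fin d)} {l : ℝ}
    (hl : Tendsto (dyadicMean u x) atTop (𝓝 l)) (k : ℤ) :
    ‖dyadicMean u x k - l‖ₑ ≤
      ∑' i : ℕ, ‖dyadicMean u x (k + i) - dyadicMean u x (k + i + 1)‖ₑ := by
  have h1 : Tendsto (fun i : ℕ => dyadicMean u x (k + i)) atTop (𝓝 l) :=
    hl.comp (tendsto_atTop_add_const_left _ k tendsto_natCast_atTop_atTop)
  have h2 := edist_le_tsum_of_edist_le_of_tendsto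
    (fun i : ℕ => ‖dyadicMean u x (k + i) - dyadicMean u x (k + i + 1)‖ₑ)
    (fun i => by rw [edist_eq_enorm_sub, Nat.cast_succ, add_assoc]) h1 0
  simpa [edist_eq_enorm_sub] using h2

/-- The kernel is replaced by its dyadic sum, whose terms are indicators of half-balls. -/
theorem setLIntegral_halfSpace_div_le {α : ℝ} (hα : 0 < α) (x : EuclideanSpace ℝ (Fin d))
    {f : EuclideanSpace ℝ (Fin (d + 1)) → ℝ≥0∞} (hf : Measurable f) :
    ∫⁻ y in halfSpace d, f y / ‖boundaryPoint x - y‖ₑ ^ α ≤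
      2 ^ α * ∑' k : ℤ, 2 ^ (k * α) * ∫⁻ y in halfBall x (dyadicRadius k), f y := by
  have hm : ∀ k : ℤ, Measurable fun y => 2 ^ (k * α) * (nearIndicator k x y * f y) := fun k => by
    have h := (measurable_nearIndicator (d := d) k).comp (measurable_prodMk_left (x := x))
    exact (h.mul hf).const_mul _
  simp_rw [setLIntegral_halfBall_dyadicRadius,
    ← lintegral_const_mul' _ _ (ENNReal.two_rpow_ne_top _)]
  rw [← lintegral_tsum fun k => (hm k).aemeasurable,
    ← lintegral_const_mul' _ _ (ENNReal.two_rpow_ne_top _)]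
  refine setLIntegral_mono' measurableSet_halfSpace fun y hy => ?_
  calc f y / ‖boundaryPoint x - y‖ₑ ^ α = ‖boundaryPoint x - y‖ₑ ^ (-α) * f y := by
        rw [ENNReal.rpow_neg, ENNReal.div_eq_inv_mul]
    _ ≤ 2 ^ α * dyadicKernel α ‖boundaryPoint x - y‖ₑ * f y := by
        gcongr
        exact rpow_neg_le_dyadicKernel hα (enorm_boundaryPoint_sub_ne_zero x hy)
    _ = _ := by
        rw [mul_assoc, dyadicKernel, ← ENNReal.tsum_mul_right]
        congr with k
        by_cases h : ‖boundaryPoint x - y‖ₑ < (2 : ℝ≥0∞) ^ (-(k : ℝ)) <;>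
          simp [nearIndicator, h]

/-- On each half-ball, `l - u y` splits through the mean at that scale. The deviation of `u` from
the mean is a single oscillation; the deviation of the mean from `l` is a tail of increments,
handled by the Hardy inequality. -/
theorem setLIntegral_conjunction_le (hp : 1 ≤ p) (hsp : 1 < s * p) (hu : Measurable u)
    {x : EuclideanSpace ℝ (Fin d)} (h : oscillationSum s p u x ≠ ∞) {l : ℝ}
    (hl : Tendsto (dyadicMean u x) atTop (𝓝 l)) :
    ∫⁻ y in halfSpace d, ‖l - u y‖ₑ ^ p /
        ‖boundaryPoint x - y‖ₑ ^ (((d + 1 : ℕ) : ℝ) - 1 + s * p) ≤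
      2 ^ (((d + 1 : ℕ) : ℝ) - 1 + s * p) * (2 ^ (p - 1) * ((unitHalfBallVolume d)⁻¹ +
        unitHalfBallVolume d * incrementConst d s p)) * oscillationSum s p u x := by
  set N : ℝ := ((d + 1 : ℕ) : ℝ) with hN
  set c := unitHalfBallVolume d with hc
  have hα : 0 < N - 1 + s * p := by
    have : 0 ≤ N := Nat.cast_nonneg _
    linarith
  refine (setLIntegral_halfSpace_div_le hα x (by fun_prop)).trans ?_
  rw [mul_assoc]
  refine mul_le_mul_right ?_ _
  have hk : ∀ k : ℤ, (2 : ℝ≥0∞) ^ (k * (N - 1 + s * p)) *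
      ∫⁻ y in halfBall x (dyadicRadius k), ‖l - u y‖ₑ ^ p ≤
      2 ^ (p - 1) * (c⁻¹ * (2 ^ (k * (2 * N + s * p - 1)) * dyadicOscillation p u x k) +
        c * (2 ^ (k * (s * p - 1)) *
        (∑' i : ℕ, ‖dyadicMean u x (k + i) - dyadicMean u x (k + i + 1)‖ₑ) ^ p)) := fun k => by
    have h1 : ∫⁻ y in halfBall x (dyadicRadius k), ‖l - u y‖ₑ ^ p ≤
        2 ^ (p - 1) * (2 ^ ((k : ℝ) * N) * c⁻¹ * dyadicOscillation p u x k +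
          2 ^ (-(k : ℝ) * N) * c *
          (∑' i : ℕ, ‖dyadicMean u x (k + i) - dyadicMean u x (k + i + 1)‖ₑ) ^ p) := by
      calc ∫⁻ y in halfBall x (dyadicRadius k), ‖l - u y‖ₑ ^ p
          ≤ ∫⁻ y in halfBall x (dyadicRadius k), 2 ^ (p - 1) *
            (‖u y - dyadicMean u x k‖ₑ ^ p + ‖dyadicMean u x k - l‖ₑ ^ p) := by
            refine lintegral_mono fun y => ?_
            refine le_trans ?_ (ENNReal.rpow_add_le_mul_rpow_add_rpow _ _ hp)
            refine ENNReal.rpow_le_rpow ?_ (by linarith)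
            rw [enorm_sub_rev, ← sub_add_sub_cancel (u y) (dyadicMean u x k) l]
            exact enorm_add_le _ _
        _ = 2 ^ (p - 1) * ((∫⁻ y in halfBall x (dyadicRadius k), ‖u y - dyadicMean u x k‖ₑ ^ p) +
              volume (halfBall x (dyadicRadius k)) * ‖dyadicMean u x k - l‖ₑ ^ p) := by
            rw [lintegral_const_mul' _ _ (ENNReal.two_rpow_ne_top _),
              lintegral_add_right _ measurable_const, setLIntegral_const, mul_comm (volume _)]
        _ ≤ _ := by
            rw [← inv_volume_halfBall_dyadicRadius x k, hc, hN,
              ← volume_halfBall_dyadicRadius x k]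
            gcongr
            · exact lintegral_enorm_sub_dyadicMean_le hp hu (dyadicOscillation_ne_top h k)
            · exact enorm_sub_dyadicMean_le hl k
    refine (mul_le_mul_right h1 _).trans_eq ?_
    have e1 : (2 : ℝ≥0∞) ^ (k * (N - 1 + s * p)) * 2 ^ ((k : ℝ) * N) =
        2 ^ (k * (2 * N + s * p - 1)) := by
      rw [ENNReal.two_rpow_mul_two_rpow]; ring_nf
    have e2 : (2 : ℝ≥0∞) ^ (k * (N - 1 + s * p)) * 2 ^ (-(k : ℝ) * N) =
        2 ^ (k * (s * p - 1)) := by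
      rw [ENNReal.two_rpow_mul_two_rpow]; ring_nf
    rw [← e1, ← e2]
    ring
  refine (ENNReal.tsum_le_tsum hk).trans ?_
  rw [ENNReal.tsum_mul_left, ENNReal.tsum_add, ENNReal.tsum_mul_left, ENNReal.tsum_mul_left,
    mul_assoc, add_mul, mul_assoc]
  gcongr
  · exact le_rfl
  · exact tsum_two_rpow_mul_tsum_enorm_sub_rpow_le hp hu h

end Pointwise

/-! ### Construction and uniqueness of the trace -/

section Trace

variable {d : ℕ} {s p : ℝ} {u u' : EuclideanSpace ℝ (Fin (d + 1)) → ℝ}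

theorem measurable_dyadicMean (hu : Measurable u) (k : ℤ) :
    Measurable fun x : EuclideanSpace ℝ (Fin d) => dyadicMean u x k := by
  have hset : MeasurableSet {q : EuclideanSpace ℝ (Fin d) × EuclideanSpace ℝ (Fin (d + 1)) |
      q.2 ∈ halfBall q.1 (dyadicRadius k)} := by
    have h1 : MeasurableSet {q : EuclideanSpace ℝ (Fin d) × EuclideanSpace ℝ (Fin (d + 1)) |
        ‖boundaryPoint q.1 - q.2‖ₑ < 2 ^ (-(k : ℝ))} :=
      measurableSet_lt (by fun_prop) measurable_const
    have h2 := h1.inter (measurable_snd measurableSet_halfSpace)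
    convert h2 using 1
    ext q
    exact mem_halfBall_dyadicRadius
  have hF : StronglyMeasurable (Function.uncurry fun (x : EuclideanSpace ℝ (Fin d))
      (y : EuclideanSpace ℝ (Fin (d + 1))) => (halfBall x (dyadicRadius k)).indicator u y) :=
    ((hu.comp measurable_snd).indicator hset).stronglyMeasurable
  have h := (hF.integral_prod_right (ν := volume)).measurable
  have heq : ∀ x : EuclideanSpace ℝ (Fin d), dyadicMean u x k =
      (2 ^ (-(k : ℝ) * ((d + 1 : ℕ) : ℝ)) * unitHalfBallVolume d).toReal⁻¹ *
        ∫ y, (halfBall x (dyadicRadius k)).indicator u y := fun x => by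
    rw [dyadicMean, setAverage_eq, integral_indicator (measurableSet_halfBall _ _),
      measureReal_def, volume_halfBall_dyadicRadius, smul_eq_mul]
  simp_rw [heq]
  exact h.const_mul _

theorem setLIntegral_halfBall_rpow_le {α : ℝ} (hα : 0 ≤ α) (x : EuclideanSpace ℝ (Fin d)) (r : ℝ)
    (f : EuclideanSpace ℝ (Fin (d + 1)) → ℝ≥0∞) :
    ∫⁻ y in halfBall x r, f y ≤ ENNReal.ofReal r ^ α *
      ∫⁻ y in halfSpace d, f y / ‖boundaryPoint x - y‖ₑ ^ α := by
  rw [← lintegral_const_mul' _ _ (ENNReal.rpow_ne_top_of_nonneg hα ENNReal.ofReal_ne_top)]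
  refine le_trans (setLIntegral_mono' (measurableSet_halfBall x r) fun y hy => ?_)
    (lintegral_mono_set (halfBall_subset_halfSpace x r))
  have h0 : ‖boundaryPoint x - y‖ₑ ^ α ≠ 0 := by
    simp [ENNReal.rpow_eq_zero_iff, enorm_boundaryPoint_sub_ne_zero x hy.2]
  have ht : ‖boundaryPoint x - y‖ₑ ^ α ≠ ∞ := ENNReal.rpow_ne_top_of_nonneg hα enorm_ne_top
  calc f y = ‖boundaryPoint x - y‖ₑ ^ α * (f y / ‖boundaryPoint x - y‖ₑ ^ α) :=
        (ENNReal.mul_div_cancel h0 ht).symm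
    _ ≤ _ := by
        gcongr
        exact (mem_ball_iff_enorm_lt.1 hy.1).le

/-- On the half-ball the kernel is at least `r ^ (-(N - 1 + sp))`, so Jensen bounds the `p`-th power
of the mean by a constant times `r ^ (-N) * r ^ (N - 1 + sp) = r ^ (sp - 1)`. This covers all radii,
not only the dyadic ones. -/
theorem tendsto_mean_of_conjunction_ne_top (hp : 1 ≤ p) (hsp : 1 < s * p) (hu : Measurable u)
    {x : EuclideanSpace ℝ (Fin d)} {l : ℝ}
    (h : ∫⁻ y in halfSpace d, ‖l - u y‖ₑ ^ p /
        ‖boundaryPoint x - y‖ₑ ^ (((d + 1 : ℕ) : ℝ) - 1 + s * p) ≠ ∞) :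
    Tendsto (fun r : ℝ => (∫⁻ y in halfBall x r, ‖u y - l‖ₑ) / volume (halfBall x r))
      (𝓝[>] 0) (𝓝 0) := by
  set J := ∫⁻ y in halfSpace d, ‖l - u y‖ₑ ^ p /
        ‖boundaryPoint x - y‖ₑ ^ (((d + 1 : ℕ) : ℝ) - 1 + s * p) with hJ
  have hp0 : 0 < p := by linarith
  have hα : 0 ≤ ((d + 1 : ℕ) : ℝ) - 1 + s * p := by
    have : (0 : ℝ) ≤ ((d + 1 : ℕ) : ℝ) := Nat.cast_nonneg _
    linarith
  have hbound : ∀ r ∈ Set.Ioi (0 : ℝ),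
      (∫⁻ y in halfBall x r, ‖u y - l‖ₑ) / volume (halfBall x r) ≤
        ((unitHalfBallVolume d)⁻¹ * J * ENNReal.ofReal r ^ (s * p - 1)) ^ p⁻¹ := by
    intro r hr
    have hr : 0 < r := hr
    have hr0 : ENNReal.ofReal r ≠ 0 := by simp [hr]
    have hV0 := volume_halfBall_ne_zero x hr
    have hVt := volume_halfBall_ne_top x r
    rw [ENNReal.le_rpow_inv_iff hp0]
    have h1 := lintegral_rpow_le_measure_univ_mul hp
      (μ := volume.restrict (halfBall x r)) (f := fun y => ‖u y - l‖ₑ) (by fun_prop)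
    rw [Measure.restrict_apply_univ] at h1
    have h2 := setLIntegral_halfBall_rpow_le hα x r fun y => ‖l - u y‖ₑ ^ p
    simp_rw [enorm_sub_rev l] at h2
    rw [ENNReal.div_rpow_of_nonneg _ _ hp0.le]
    calc (∫⁻ y in halfBall x r, ‖u y - l‖ₑ) ^ p / volume (halfBall x r) ^ p
        ≤ volume (halfBall x r) ^ (p - 1) *
          (ENNReal.ofReal r ^ (((d + 1 : ℕ) : ℝ) - 1 + s * p) * J) / volume (halfBall x r) ^ p := by
          gcongr
          refine h1.trans (mul_le_mul_right (h2.trans_eq ?_) _)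
          rw [hJ]
          simp_rw [enorm_sub_rev l]
      _ = (volume (halfBall x r))⁻¹ *
          (ENNReal.ofReal r ^ (((d + 1 : ℕ) : ℝ) - 1 + s * p) * J) := by
          rw [ENNReal.div_eq_inv_mul, ← ENNReal.rpow_neg, ← mul_assoc,
            ← ENNReal.rpow_add _ _ hV0 hVt, show -p + (p - 1) = -1 by ring,
            ENNReal.rpow_neg_one]
      _ = _ := by
          rw [volume_halfBall x hr, ENNReal.mul_inv (Or.inl (by simp [hr])) (Or.inl (by simp)),
            ← ENNReal.rpow_natCast, ← ENNReal.rpow_neg]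
          have : ENNReal.ofReal r ^ (-((d + 1 : ℕ) : ℝ)) *
              ENNReal.ofReal r ^ (((d + 1 : ℕ) : ℝ) - 1 + s * p) =
              ENNReal.ofReal r ^ (s * p - 1) := by
            rw [← ENNReal.rpow_add _ _ hr0 ENNReal.ofReal_ne_top]; ring_nf
          rw [← this]
          ring
  have hlim : Tendsto (fun r : ℝ =>
      ((unitHalfBallVolume d)⁻¹ * J * ENNReal.ofReal r ^ (s * p - 1)) ^ p⁻¹)
      (𝓝[>] 0) (𝓝 0) := by
    have hK : (unitHalfBallVolume d)⁻¹ * J ≠ ∞ :=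
      ENNReal.mul_ne_top (ENNReal.inv_ne_top.2 unitHalfBallVolume_ne_zero) h
    have hc : Continuous fun r : ℝ =>
        ((unitHalfBallVolume d)⁻¹ * J * ENNReal.ofReal r ^ (s * p - 1)) ^ p⁻¹ :=
      ENNReal.continuous_rpow_const.comp ((ENNReal.continuous_const_mul hK).comp
        (ENNReal.continuous_rpow_const.comp ENNReal.continuous_ofReal))
    have := hc.tendsto 0
    rw [ENNReal.ofReal_zero, ENNReal.zero_rpow_of_pos (by linarith), mul_zero,
      ENNReal.zero_rpow_of_pos (by positivity)] at this
    exact this.mono_left nhdsWithin_le_nhds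
  refine tendsto_of_tendsto_of_tendsto_of_le_of_le' tendsto_const_nhds hlim
    (Eventually.of_forall fun _ => zero_le) ?_
  filter_upwards [self_mem_nhdsWithin] with r hr using hbound r hr

/-- The constant `|w x - v x|` is at most the sum of the two means over every half-ball, and both
tend to zero. -/
theorem IsTrace.ae_eq {v w : EuclideanSpace ℝ (Fin d) → ℝ}
    (hu : AEMeasurable u (volume.restrict (halfSpace d))) (hw : IsTrace u w) (hv : IsTrace u v) :
    w =ᵐ[volume] v := by
  filter_upwards [hw.tendsto_mean, hv.tendsto_mean] with x hwx hvx
  have hsum := hwx.add hvx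
  rw [add_zero] at hsum
  have hle : ‖w x - v x‖ₑ ≤ 0 := by
    refine ge_of_tendsto hsum ?_
    filter_upwards [self_mem_nhdsWithin] with r hr
    have hV0 := volume_halfBall_ne_zero x (Set.mem_Ioi.1 hr)
    have hVt := volume_halfBall_ne_top x r
    have hm : AEMeasurable u (volume.restrict (halfBall x r)) :=
      hu.mono_measure (Measure.restrict_mono (halfBall_subset_halfSpace x r) le_rfl)
    change _ ≤ (∫⁻ y in halfBall x r, ‖u y - w x‖ₑ) / volume (halfBall x r) +
      (∫⁻ y in halfBall x r, ‖u y - v x‖ₑ) / volume (halfBall x r)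
    rw [← ENNReal.add_div, ENNReal.le_div_iff_mul_le (Or.inl hV0) (Or.inl hVt),
      ← setLIntegral_const, ← lintegral_add_left' (by fun_prop)]
    refine lintegral_mono fun y => ?_
    rw [enorm_sub_rev (u y) (w x), ← sub_add_sub_cancel (w x) (u y) (v x)]
    exact enorm_add_le _ _
  rwa [nonpos_iff_eq_zero, enorm_eq_zero, sub_eq_zero] at hle

theorem gagliardoIntegral_congr_ae (h : u =ᵐ[volume.restrict (halfSpace d)] u') :
    gagliardoIntegral d s p u = gagliardoIntegral d s p u' := by
  refine lintegral_congr_ae ?_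
  filter_upwards [h] with y hy
  refine lintegral_congr_ae ?_
  filter_upwards [h] with z hz
  rw [hy, hz]

theorem conjunctionIntegral_congr_ae {v : EuclideanSpace ℝ (Fin d) → ℝ}
    (h : u =ᵐ[volume.restrict (halfSpace d)] u') :
    conjunctionIntegral d s p u v = conjunctionIntegral d s p u' v := by
  refine lintegral_congr fun x => lintegral_congr_ae ?_
  filter_upwards [h] with y hy
  rw [hy]

theorem IsTrace.congr_ae {v : EuclideanSpace ℝ (Fin d) → ℝ} (hv : IsTrace u v)
    (h : u =ᵐ[volume.restrict (halfSpace d)] u') : IsTrace u' v := by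
  refine ⟨hv.aemeasurable, ?_⟩
  filter_upwards [hv.tendsto_mean] with x hx
  refine hx.congr fun r => ?_
  congr 1
  refine lintegral_congr_ae ?_
  filter_upwards [ae_mono (Measure.restrict_mono (halfBall_subset_halfSpace x r) le_rfl) h] with y hy
  rw [hy]

theorem exists_isTrace_conjunctionIntegral_le (d : ℕ) (hs : 0 < s) (hp : 1 ≤ p)
    (hsp : 1 < s * p) :
    ∃ C : ℝ≥0∞, C ≠ ∞ ∧ ∀ u : EuclideanSpace ℝ (Fin (d + 1)) → ℝ, Measurable u →
      gagliardoIntegral d s p u < ∞ → ∃ v : EuclideanSpace ℝ (Fin d) → ℝ, IsTrace u v ∧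
        conjunctionIntegral d s p u v ≤ C * gagliardoIntegral d s p u := by
  obtain ⟨C, hC, hCu⟩ := lintegral_oscillationSum_le d hs hp
  set K : ℝ≥0∞ := 2 ^ (((d + 1 : ℕ) : ℝ) - 1 + s * p) * (2 ^ (p - 1) * ((unitHalfBallVolume d)⁻¹ +
    unitHalfBallVolume d * incrementConst d s p)) with hK
  have hKt : K ≠ ∞ := by
    refine ENNReal.mul_ne_top (ENNReal.two_rpow_ne_top _) (ENNReal.mul_ne_top
      (ENNReal.two_rpow_ne_top _) (ENNReal.add_ne_top.2 ⟨?_, ?_⟩))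
    · exact ENNReal.inv_ne_top.2 unitHalfBallVolume_ne_zero
    · exact ENNReal.mul_ne_top unitHalfBallVolume_ne_top (incrementConst_ne_top d hp hsp)
  refine ⟨K * C, ENNReal.mul_ne_top hKt hC, fun u hu hG => ?_⟩
  have hfin : ∀ᵐ x : EuclideanSpace ℝ (Fin d), oscillationSum s p u x < ∞ :=
    ae_lt_top (measurable_oscillationSum hu s)
      ((hCu u hu).trans_lt (ENNReal.mul_lt_top hC.lt_top hG)).ne
  obtain ⟨v, hvm, hv⟩ := measurable_limit_of_tendsto_metrizable_ae
    (f := fun (k : ℤ) (x : EuclideanSpace ℝ (Fin d)) => dyadicMean u x k) (L := atTop)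
    (fun k => (measurable_dyadicMean hu k).aemeasurable)
    (hfin.mono fun x hx => exists_tendsto_dyadicMean hp hsp hu hx.ne)
  have hJ : ∀ᵐ x : EuclideanSpace ℝ (Fin d), ∫⁻ y in halfSpace d, ‖v x - u y‖ₑ ^ p /
      ‖boundaryPoint x - y‖ₑ ^ (((d + 1 : ℕ) : ℝ) - 1 + s * p) ≤ K * oscillationSum s p u x := by
    filter_upwards [hfin, hv] with x hx hvx
    exact setLIntegral_conjunction_le hp hsp hu hx.ne hvx
  refine ⟨v, ⟨hvm.aemeasurable, ?_⟩, ?_⟩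
  · filter_upwards [hfin, hJ] with x hx hJx
    exact tendsto_mean_of_conjunction_ne_top hp hsp hu
      (hJx.trans_lt (ENNReal.mul_lt_top hKt.lt_top hx)).ne
  · refine (lintegral_mono_ae hJ).trans ?_
    rw [lintegral_const_mul' _ _ hKt, mul_assoc K C]
    exact mul_le_mul_right (hCu u hu) _

end Trace

/-! ### The main theorem -/

theorem theorem3p1 (d : ℕ) (hd : 1 ≤ d) (s p : ℝ) (hs₀ : 0 < s) (hs₁ : s < 1) (hp : 1 ≤ p)
    (hsp : 1 < s * p) :
    ∃ C : ℝ≥0, 0 < C ∧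
      ∀ u : EuclideanSpace ℝ (Fin (d + 1)) → ℝ, MemHomogeneousSobolev d s p u →
        ∃ v : EuclideanSpace ℝ (Fin d) → ℝ, IsTrace u v ∧
          (∀ w : EuclideanSpace ℝ (Fin d) → ℝ, IsTrace u w → w =ᵐ[volume] v) ∧
          conjunctionIntegral d s p u v ≤ C * gagliardoIntegral d s p u := by
  obtain ⟨C, hC, hCu⟩ := exists_isTrace_conjunctionIntegral_le d hs₀ hp hsp
  -- Adding one makes the constant positive.
  refine ⟨C.toNNReal + 1, by positivity, fun u hu => ?_⟩
  -- The estimates need a measurable function; both integrals and the trace depend only on the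
  -- almost-everywhere class of `u` on the half-space.
  have hae := hu.aemeasurable.ae_eq_mk
  obtain ⟨v, hv, hle⟩ := hCu _ hu.aemeasurable.measurable_mk
    (gagliardoIntegral_congr_ae (s := s) (p := p) hae ▸ hu.gagliardoIntegral_lt_top)
  have hv' : IsTrace u v := hv.congr_ae hae.symm
  refine ⟨v, hv', fun w hw => hw.ae_eq hu.aemeasurable hv', ?_⟩
  rw [conjunctionIntegral_congr_ae hae, gagliardoIntegral_congr_ae hae]
  refine hle.trans (mul_le_mul_left ?_ _)
  rw [ENNReal.coe_add, ENNReal.coe_toNNReal hC]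
  exact le_self_add
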